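/- All graphs are finite and simple. For a graph $G=(V,E)$, let $\delta(v)$ be the set of edges incident to a vertex $v$ and, for $W\subseteq V$, let $E(W)$ be the set of edges with both endpoints in $W$; write $x(W)=\sum_{v\in W}x_v$ and $y(F)=\sum_{e\in F}y_e$. A hole is an induced cycle of length at least $4$, and $G$ is chordal if it contains no hole. A co-2-plex of $G$ is a set $S\subseteq V$ such that the induced subgraph $G[S]$ has maximum degree at most $1$. Let $\chi^S\in\{0,1\}^V$ and $\zeta^{F}\in\{0,1\}^E$ denote the incidence vectors of $S\subseteq V$ and $F\subseteq E$, and let $$\mathcal P_{x,y}(G)=\operatorname{conv}\{(\chi^S,\zeta^{E(S)}) : S \text{ is a co-2-plex of } G\}\subseteq\mathbb R^V\times\mathbb R^E .$$ **Theorem.** A graph $G$ is chordal if and only if $\mathcal P_{x,y}(G)$ is the set of all $(x,y)\in\mathbb R^V\times\mathbb R^E$ satisfying $$y(\delta(v))\le x_v\ \text{ for all } v\in V,\qquad y_e\ge 0\ \text{ for all } e\in E,\qquad x(K)-y(E(K))\le 1\ \text{ for all maximal cliques } K \text{ of } G .$$ Consequently, $\mathcal P_{x,y}(G)$ has a compact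 description for chordal graphs: there is a polynomial $q$ with coefficients in $\mathbb N$ such that, for every chordal graph $G$, the linear system above describes $\mathcal P_{x,y}(G)$ and has total encoding length (the number of bits of all its coefficients, zeros included, and right-hand sides) at most $q(|V|)$; in particular it has at most $q(|V|)$ inequalities. -/

import Mathlib

universe u

namespace CoTwoPlex

noncomputable section

/-- `G` is chordal: it contains no hole, i.e. no induced cycle of length at least four. -/
def IsChordal {V : Type u} (G : SimpleGraph V) : Prop :=
  ∀ n : ℕ, 4 ≤ n → IsEmpty (SimpleGraph.cycleGraph n ↪g G)

open Classical in
/-- `S` is a co-`k`-plex: the subgraph induced by `S` has maximum degree at most `k - 1`. -/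
def IsCoPlex {V : Type u} (G : SimpleGraph V) (k : ℕ) (S : Finset V) : Prop :=
  ∀ v ∈ S, (S.filter (fun w => G.Adj v w)).card < k

/-- `K` is an inclusionwise maximal clique of `G`. -/
def IsMaximalClique {V : Type u} (G : SimpleGraph V) (K : Finset V) : Prop :=
  Maximal (fun L : Finset V => G.IsClique (L : Set V)) K

/-- The space `ℝ^V × ℝ^E` of the points `(x, y)`. -/
abbrev Point {V : Type u} (G : SimpleGraph V) : Type u :=
  (V → ℝ) × (G.edgeSet → ℝ)

open Classical in
/-- The set `δ(v)` of the edges incident to `v`. -/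
def delta {V : Type u} [Fintype V] (G : SimpleGraph V) (v : V) : Finset G.edgeSet :=
  Finset.univ.filter (fun e => v ∈ (e : Sym2 V))

open Classical in
/-- The set `E(W)` of the edges having both endpoints in `W`. -/
def edgesIn {V : Type u} [Fintype V] (G : SimpleGraph V) (W : Finset V) : Finset G.edgeSet :=
  Finset.univ.filter (fun e => ∀ w ∈ (e : Sym2 V), w ∈ W)

open Classical in
/-- The point `(χ^S, ζ^{E(S)})`: the incidence vectors of `S` and of `E(S)`. -/
def incidencePoint {V : Type u} [Fintype V] (G : SimpleGraph V) (S : Finset V) : Point G :=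
  (fun v => if v ∈ S then 1 else 0, fun e => if e ∈ edgesIn G S then 1 else 0)

/-- The polytope `P_{x,y}(G)`: the convex hull of the points `(χ^S, ζ^{E(S)})`, where `S` runs
over the co-2-plexes of `G`. -/
def extendedPolytope {V : Type u} [Fintype V] (G : SimpleGraph V) : Set (Point G) :=
  convexHull ℝ {p | ∃ S : Finset V, IsCoPlex G 2 S ∧ p = incidencePoint G S}

/-- A linear inequality `∑ v, a v * x v + ∑ e, b e * y e ≤ c` with integer coefficients. -/
structure LinIneq {V : Type u} (G : SimpleGraph V) where
  a : V → ℤ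
  b : G.edgeSet → ℤ
  c : ℤ

open Classical in
/-- The point `p = (x, y)` satisfies the linear inequality. -/
def LinIneq.Holds {V : Type u} [Fintype V] {G : SimpleGraph V} (I : LinIneq G) (p : Point G) :
    Prop :=
  ∑ v, (I.a v : ℝ) * p.1 v + ∑ e, (I.b e : ℝ) * p.2 e ≤ (I.c : ℝ)

/-- The polyhedron described by a finite system of linear inequalities. -/
def solutionSet {V : Type u} [Fintype V] {G : SimpleGraph V} (S : Finset (LinIneq G)) :
    Set (Point G) :=
  {p | ∀ I ∈ S, I.Holds p}

/-- The number of bits that encode an integer: one for the sign and those of the absolute value. -/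
def bitSize (z : ℤ) : ℕ := 1 + z.natAbs.size

open Classical in
/-- The encoding length of a linear system, written densely: the total number of bits of all
coefficients (zeros included) and right-hand sides. In particular it is at least the number of
inequalities, and at least the number of inequalities times the number of variables. -/
def encodingSize {V : Type u} [Fintype V] {G : SimpleGraph V} (S : Finset (LinIneq G)) : ℕ :=
  ∑ I ∈ S, (∑ v, bitSize (I.a v) + ∑ e, bitSize (I.b e) + bitSize I.c)

open Classical in
/-- The inequality `y(δ(v)) ≤ x_v`, as `-x_v + y(δ(v)) ≤ 0`. -/
def deltaIneq {V : Type u} [Fintype V] (G : SimpleGraph V) (v : V) : LinIneq G where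
  a := fun w => if w = v then -1 else 0
  b := fun e => if e ∈ delta G v then 1 else 0
  c := 0

open Classical in
/-- The inequality `-y_e ≤ 0`. -/
def nonnegIneq {V : Type u} (G : SimpleGraph V) (e : G.edgeSet) : LinIneq G where
  a := fun _ => 0
  b := fun f => if f = e then -1 else 0
  c := 0

open Classical in
/-- The inequality `x(K) - y(E(K)) ≤ 1`. -/
def cliqueIneq {V : Type u} [Fintype V] (G : SimpleGraph V) (K : Finset V) : LinIneq G where
  a := fun v => if v ∈ K then 1 else 0
  b := fun e => if e ∈ edgesIn G K then -1 else 0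
  c := 1

open Classical in
/-- The linear system made of the three families `y(δ(v)) ≤ x_v` for all vertices `v`,
`-y_e ≤ 0` for all edges `e`, and `x(K) - y(E(K)) ≤ 1` for all maximal cliques `K`. -/
def cliqueSystem {V : Type u} [Fintype V] (G : SimpleGraph V) : Finset (LinIneq G) :=
  Finset.univ.image (deltaIneq G) ∪ Finset.univ.image (nonnegIneq G) ∪
    (Finset.univ.filter (IsMaximalClique G)).image (cliqueIneq G)

/-- The solution set of `cliqueSystem G`, written out. -/
theorem mem_solutionSet_cliqueSystem {V : Type u} [Fintype V] (G : SimpleGraph V) (p : Point G) :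
    p ∈ solutionSet (cliqueSystem G) ↔
      (∀ v, ∑ e ∈ delta G v, p.2 e ≤ p.1 v) ∧ (∀ e, 0 ≤ p.2 e) ∧
        ∀ K, IsMaximalClique G K → ∑ v ∈ K, p.1 v - ∑ e ∈ edgesIn G K, p.2 e ≤ 1 := by
  classical
  have h1 : ∀ v, (deltaIneq G v).Holds p ↔ ∑ e ∈ delta G v, p.2 e ≤ p.1 v := by
    intro v
    simp [LinIneq.Holds, deltaIneq, ite_mul, Finset.sum_ite_mem]
  have h2 : ∀ e, (nonnegIneq G e).Holds p ↔ 0 ≤ p.2 e := by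
    intro e
    simp [LinIneq.Holds, nonnegIneq, ite_mul]
  have h3 : ∀ K, (cliqueIneq G K).Holds p ↔
      ∑ v ∈ K, p.1 v - ∑ e ∈ edgesIn G K, p.2 e ≤ 1 := by
    intro K
    simp [LinIneq.Holds, cliqueIneq, ite_mul, Finset.sum_ite_mem, sub_eq_add_neg,
      Finset.sum_neg_distrib]
  simp only [solutionSet, cliqueSystem, Set.mem_ofPred_eq, Finset.mem_union, Finset.mem_image,
    Finset.mem_filter, Finset.mem_univ, true_and]
  constructor
  · intro h
    exact ⟨fun v => (h1 v).1 (h _ (Or.inl (Or.inl ⟨v, rfl⟩))),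
      fun e => (h2 e).1 (h _ (Or.inl (Or.inr ⟨e, rfl⟩))),
      fun K hK => (h3 K).1 (h _ (Or.inr ⟨K, hK, rfl⟩))⟩
  · rintro ⟨a, b, c⟩ I ((⟨v, rfl⟩ | ⟨e, rfl⟩) | ⟨K, hK, rfl⟩)
    · exact (h1 v).2 (a v)
    · exact (h2 e).2 (b e)
    · exact (h3 K).2 (c K hK)

end

end CoTwoPlex

namespace CoTwoPlex

open Finset

/-! Put weights on the "pieces" of `G`, its vertices and edges: x_v - y(δ(v)) on v and y_e on e.
This is an invertible linear change of coordinates. The first two families of inequalities say that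
the weights are nonnegative, and x(K) - y(E(K)) is the total weight of the pieces meeting K
(`sum_weight_eq`). Call two pieces in conflict if they share a vertex or are joined by an edge. A
co-2-plex is a disjoint union of single vertices and single edges without further edges between
them, that is, a conflict-free set of pieces. So for chordal graphs one has to show that the weights
are a convex combination of conflict-free sets.

A chordal graph has a perfect elimination ordering (`IsChordal.exists_simplicial`). Remove the
pieces in the order of their last vertices. If d is the last vertex of the removed piece, every
remaining piece in conflict with it meets the clique formed by d and its later neighbours
(`IsPerfectElimination.exists_mem_piece`). Hence these pieces are pairwise in conflict and, by the
clique inequality, of weight at most one, and greedy colouring (`mem_convexHull_independent`) gives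
the convex combination.

Conversely, on a hole there is a point that satisfies the system but lies outside the polytope. If
it were inside, some co-2-plex would be tight wherever the point is tight (`exists_tight_coPlex`),
and parity around the hole excludes this. For odd holes the point is 1/2 on the hole; for even holes
one vertex and its two hole edges are raised by 1/2.

The elimination ordering also bounds the number of maximal cliques, hence the size of the system. -/

/-! ### Chordal graphs: simplicial vertices and elimination orderings -/

/-- The spanning subgraph of `G` whose edges are those with both endpoints in `s`. -/
def restrict {V : Type u} (G : SimpleGraph V) (s : Set V) : SimpleGraph V where
  Adj a b := G.Adj a b ∧ a ∈ s ∧ b ∈ s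
  symm := ⟨fun _ _ h => ⟨h.1.symm, h.2.2, h.2.1⟩⟩
  loopless := ⟨fun _ h => h.1.ne rfl⟩

theorem restrict_mono {V : Type u} (G : SimpleGraph V) {s t : Set V} (h : s ⊆ t) :
    restrict G s ≤ restrict G t :=
  fun _ _ hab => ⟨hab.1, h hab.2.1, h hab.2.2⟩

theorem cycleGraph_adj_iff_val {n : ℕ} (hn : 2 ≤ n) (i j : Fin n) :
    (SimpleGraph.cycleGraph n).Adj i j ↔
      j.val = i.val + 1 ∨ i.val = j.val + 1 ∨ (i.val = 0 ∧ j.val + 1 = n) ∨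
        (j.val = 0 ∧ i.val + 1 = n) := by
  have hi := i.isLt
  have hj := j.isLt
  rw [SimpleGraph.cycleGraph_adj']
  rcases lt_trichotomy i j with h | h | h
  · rw [Fin.coe_sub_iff_lt.2 h, Fin.sub_val_of_le h.le]
    have : i.val < j.val := h
    omega
  · subst h
    rw [Fin.sub_val_of_le le_rfl]
    omega
  · rw [Fin.coe_sub_iff_lt.2 h, Fin.sub_val_of_le h.le]
    have : j.val < i.val := h
    omega

theorem dist_getVert_of_length_eq_dist {V : Type u} {H : SimpleGraph V} {s t : V}
    (w : H.Walk s t) (hw : w.length = H.dist s t) {i : ℕ} (hi : i ≤ w.length) :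
    H.dist s (w.getVert i) = i := by
  have h1 : H.dist s (w.getVert i) ≤ i := by
    have := SimpleGraph.dist_le (w.take i)
    rw [SimpleGraph.Walk.take_length] at this
    omega
  have h2 : H.dist (w.getVert i) t ≤ w.length - i := by
    have := SimpleGraph.dist_le (w.drop i)
    rwa [SimpleGraph.Walk.drop_length] at this
  have h3 := (w.take i).reachable.dist_triangle_left t
  omega

/-- A shortest path from `s` to `t` with interior in `A` is induced, and `x` sees only its ends. If
`s` and `t` were not adjacent, the path would close up through `x` to a hole. -/
theorem IsChordal.adj_of_reachable {V : Type u} {G : SimpleGraph V} (hG : IsChordal G)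
    {x s t : V} (hs : G.Adj x s) (ht : G.Adj x t) (hst : s ≠ t) {A : Set V}
    (hA : ∀ a ∈ A, a ≠ x ∧ ¬ G.Adj x a) (hr : (restrict G (A ∪ {s, t})).Reachable s t) :
    G.Adj s t := by
  by_contra hnadj
  set H := restrict G (A ∪ {s, t})
  obtain ⟨w, hw⟩ := hr.exists_walk_length_eq_dist
  have hk : 1 < w.length := by
    rw [hw]
    exact hr.one_lt_dist_of_ne_of_not_adj hst fun h => hnadj h.1
  have hd : ∀ i, i ≤ w.length → H.dist s (w.getVert i) = i :=
    fun i hi => dist_getVert_of_length_eq_dist w hw hi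
  have hmem : ∀ i, i ≤ w.length → w.getVert i ∈ A ∪ {s, t} := by
    intro i hi
    rcases hi.lt_or_eq with h | h
    · exact (w.adj_getVert_succ h).2.1
    · rw [h, w.getVert_length]
      simp
  have hinj : ∀ i j, i ≤ w.length → j ≤ w.length → w.getVert i = w.getVert j → i = j := by
    intro i j hi hj h
    rw [← hd i hi, ← hd j hj, h]
  have hx : ∀ i, i ≤ w.length → (G.Adj x (w.getVert i) ↔ i = 0 ∨ i = w.length) := by
    intro i hi
    constructor
    · intro h
      rcases hmem i hi with h' | h' | h'
      · exact absurd h (hA _ h').2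
      · left
        exact hinj i 0 hi (Nat.zero_le _) (by rw [h', w.getVert_zero])
      · right
        exact hinj i _ hi le_rfl (by rw [w.getVert_length]; exact h')
    · rintro (rfl | rfl)
      · simpa using hs
      · simpa using ht
  have hxne : ∀ i, i ≤ w.length → x ≠ w.getVert i := by
    intro i hi h
    rcases hmem i hi with h' | h' | h'
    · exact (hA _ h').1 h.symm
    · exact hs.ne (h.trans h')
    · exact ht.ne (h.trans h')
  have hp : ∀ i j, i ≤ w.length → j ≤ w.length →
      (G.Adj (w.getVert i) (w.getVert j) ↔ j = i + 1 ∨ i = j + 1) := by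
    intro i j hi hj
    constructor
    · intro h
      have hH' : H.Adj (w.getVert i) (w.getVert j) := ⟨h, hmem i hi, hmem j hj⟩
      have hne : i ≠ j := fun h' => h.ne (by rw [h'])
      have := hH'.diff_dist_adj (u := s)
      rw [hd i hi, hd j hj] at this
      omega
    · rintro (rfl | rfl)
      · exact (w.adj_getVert_succ (by omega)).1
      · exact (w.adj_getVert_succ (by omega)).1.symm
  have hle : ∀ i : Fin (w.length + 1), i.val ≤ w.length := fun i => Nat.lt_succ_iff.1 i.isLt
  -- The hole is `x` followed by the `w.length + 1` vertices of the path; its length is at least 4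
  -- because `w.length` is at least 2.
  refine (hG (w.length + 1 + 1) (by omega)).false
    ⟨⟨Fin.cons x fun i : Fin (w.length + 1) => w.getVert i, ?_⟩, ?_⟩
  · intro i j
    refine Fin.cases ?_ (fun i => ?_) i <;> refine Fin.cases ?_ (fun j => ?_) j
    · simp
    · simpa using fun h => absurd h (hxne j (hle j))
    · simpa using fun h => absurd h.symm (hxne i (hle i))
    · intro h
      simp only [Fin.cons_succ] at h
      exact congrArg Fin.succ (Fin.ext (hinj i j (hle i) (hle j) h))
  · intro i j
    rw [cycleGraph_adj_iff_val (by omega)]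
    refine Fin.cases ?_ (fun i => ?_) i <;> refine Fin.cases ?_ (fun j => ?_) j
    · simp
    · change G.Adj x (w.getVert j) ↔ _
      rw [hx j (hle j), Fin.val_zero, Fin.val_succ]
      omega
    · change G.Adj (w.getVert i) x ↔ _
      rw [G.adj_comm, hx i (hle i), Fin.val_zero, Fin.val_succ]
      omega
    · change G.Adj (w.getVert i) (w.getVert j) ↔ _
      rw [hp i j (hle i) (hle j), Fin.val_succ, Fin.val_succ]
      omega

/-- Dirac's theorem, in the form that lends itself to induction: a clique which is not all of `W`
misses some simplicial vertex of `G[W]`. -/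
theorem IsChordal.exists_simplicial {V : Type u} {G : SimpleGraph V} (hG : IsChordal G)
    (W : Finset V) : ∀ K : Finset V, G.IsClique (K : Set V) → (∃ y ∈ W, y ∉ K) → K ⊆ W →
      ∃ v ∈ W, v ∉ K ∧
        ∀ a ∈ W, ∀ b ∈ W, G.Adj v a → G.Adj v b → a ≠ b → G.Adj a b := by
  classical
  induction W using Finset.strongInduction with
  | H W ih =>
  intro K hK hy hKW
  -- Is there a vertex `x` whose closed neighbourhood contains `K` but not all of `W`?
  by_cases hc : ∃ x ∈ W, (∀ k ∈ K, k = x ∨ G.Adj x k) ∧ ∃ z ∈ W, z ≠ x ∧ ¬ G.Adj x z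
  · obtain ⟨x, hxW, hxK, z, hzW, hzx, hxz⟩ := hc
    set A : Set V := {a | a ∈ W ∧ a ≠ x ∧ ¬ G.Adj x a}
    have hA : ∀ a ∈ A, a ≠ x ∧ ¬ G.Adj x a := fun a ha => ha.2
    -- `C` is the component of `z` among the non-neighbours of `x`, and `S` is its attachment in the
    -- neighbourhood of `x`. Since `S` is a clique, induction on `C ∪ S`, which lacks `x`, gives a
    -- simplicial vertex in `C`. All its neighbours in `W` lie in `C ∪ S`, and it avoids `K` because
    -- `K` lies in the closed neighbourhood of `x`.
    set C : Finset V := W.filter fun a => a ∈ A ∧ (restrict G A).Reachable z a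
    set S : Finset V := W.filter fun s => G.Adj x s ∧ ∃ c ∈ C, G.Adj s c
    have hS : G.IsClique (S : Set V) := by
      intro s hs t ht hst
      obtain ⟨-, hxs, c, hc, hsc⟩ := Finset.mem_filter.1 hs
      obtain ⟨-, hxt, d, hd, htd⟩ := Finset.mem_filter.1 ht
      obtain ⟨-, hcA, hzc⟩ := Finset.mem_filter.1 hc
      obtain ⟨-, hdA, hzd⟩ := Finset.mem_filter.1 hd
      refine hG.adj_of_reachable hxs hxt hst hA ?_
      have h1 : (restrict G (A ∪ {s, t})).Adj s c := ⟨hsc, by simp, Or.inl hcA⟩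
      have h2 : (restrict G (A ∪ {s, t})).Adj t d := ⟨htd, by simp, Or.inl hdA⟩
      have h3 : (restrict G (A ∪ {s, t})).Reachable c d :=
        (hzc.symm.trans hzd).mono (restrict_mono G Set.subset_union_left)
      exact h1.reachable.trans (h3.trans h2.reachable.symm)
    have hsub : C ∪ S ⊂ W := by
      refine (Finset.ssubset_iff_of_subset
        (Finset.union_subset (Finset.filter_subset _ _) (Finset.filter_subset _ _))).2
        ⟨x, hxW, fun hx => ?_⟩
      rcases Finset.mem_union.1 hx with h | h
      · exact (Finset.mem_filter.1 h).2.1.2.1 rfl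
      · exact (Finset.mem_filter.1 h).2.1.ne rfl
    have hzA : z ∈ A := ⟨hzW, hzx, hxz⟩
    have hzC : z ∈ C := Finset.mem_filter.2 ⟨hzW, hzA, SimpleGraph.Reachable.refl _⟩
    obtain ⟨v, hv, hvS, hsimp⟩ := ih _ hsub S hS
      ⟨z, Finset.mem_union_left _ hzC, fun h => hxz (Finset.mem_filter.1 h).2.1⟩
      Finset.subset_union_right
    have hvC : v ∈ C := (Finset.mem_union.1 hv).resolve_right hvS
    obtain ⟨hvW, hvA, hzv⟩ := Finset.mem_filter.1 hvC
    have hnb : ∀ a ∈ W, G.Adj v a → a ∈ C ∪ S := by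
      intro a ha hva
      by_cases hxa : G.Adj x a
      · exact Finset.mem_union_right _ (Finset.mem_filter.2 ⟨ha, hxa, v, hvC, hva.symm⟩)
      · have haA : a ∈ A := by
          refine ⟨ha, fun h => ?_, hxa⟩
          subst h
          exact hvA.2.2 hva.symm
        have hadj : (restrict G A).Adj v a := ⟨hva, hvA, haA⟩
        exact Finset.mem_union_left _
          (Finset.mem_filter.2 ⟨ha, haA, hzv.trans hadj.reachable⟩)
    refine ⟨v, hvW, fun hvK => ?_, fun a ha b hb hva hvb hab =>
      hsimp a (hnb a ha hva) b (hnb b hb hvb) hva hvb hab⟩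
    rcases hxK v hvK with h | h
    · exact hvA.2.1 h
    · exact hvA.2.2 h
  -- Each vertex of `K` is now adjacent to all of `W`, so every vertex of `W` sees all of `K` and is
  -- itself universal: `W` is a clique.
  · push Not at hc
    have hKuniv : ∀ x ∈ K, ∀ z ∈ W, z ≠ x → G.Adj x z := by
      intro x hx
      refine hc x (hKW hx) fun k hk => ?_
      by_cases h : k = x
      · exact Or.inl h
      · exact Or.inr (hK hx hk (Ne.symm h))
    have huniv : ∀ x ∈ W, ∀ z ∈ W, z ≠ x → G.Adj x z := by
      intro x hx
      refine hc x hx fun k hk => ?_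
      by_cases h : k = x
      · exact Or.inl h
      · exact Or.inr (hKuniv k hk x hx (Ne.symm h)).symm
    obtain ⟨y, hyW, hyK⟩ := hy
    exact ⟨y, hyW, hyK, fun a ha b hb _ _ hab => huniv a ha b hb hab.symm⟩

/-- `ord` is a perfect elimination ordering of `G`: the later neighbours of each vertex form a
clique. -/
structure IsPerfectElimination {V : Type u} (G : SimpleGraph V) (ord : V → ℕ) : Prop where
  injective : Function.Injective ord
  adj : ∀ {v a b : V}, ord v < ord a → ord v < ord b → G.Adj v a → G.Adj v b → a ≠ b → G.Adj a b

theorem IsChordal.exists_isPerfectElimination {V : Type u} [Fintype V] {G : SimpleGraph V}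
    (hG : IsChordal G) : ∃ ord : V → ℕ, IsPerfectElimination G ord := by
  classical
  have key : ∀ W : Finset V, ∃ ord : V → ℕ, Set.InjOn ord W ∧
      ∀ v ∈ W, ∀ a ∈ W, ∀ b ∈ W, ord v < ord a → ord v < ord b → G.Adj v a → G.Adj v b →
        a ≠ b → G.Adj a b := by
    intro W
    induction W using Finset.strongInduction with
    | H W ih =>
    rcases W.eq_empty_or_nonempty with rfl | ⟨y, hy⟩
    · exact ⟨fun _ => 0, by simp⟩
    · obtain ⟨v, hv, -, hsimp⟩ := hG.exists_simplicial W ∅ (by simp) ⟨y, hy, by simp⟩ (by simp)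
      obtain ⟨ord, hinj, hord⟩ := ih (W.erase v) (Finset.erase_ssubset hv)
      refine ⟨fun a => if a = v then 0 else ord a + 1, ?_, ?_⟩
      · intro a ha b hb hab
        by_cases h1 : a = v <;> by_cases h2 : b = v <;> simp [h1, h2] at hab ⊢
        exact hinj (by simpa [h1] using ha) (by simpa [h2] using hb) hab
      · intro u hu a ha b hb hua hub h1 h2 h3
        by_cases huv : u = v
        · subst huv
          exact hsimp a ha b hb h1 h2 h3
        · have hav : a ≠ v := by rintro rfl; simp at hua
          have hbv : b ≠ v := by rintro rfl; simp at hub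
          simp only [huv, hav, hbv, if_false] at hua hub
          exact hord u (Finset.mem_erase.2 ⟨huv, hu⟩) a (Finset.mem_erase.2 ⟨hav, ha⟩) b
            (Finset.mem_erase.2 ⟨hbv, hb⟩) (by omega) (by omega) h1 h2 h3
  obtain ⟨ord, hinj, hord⟩ := key Finset.univ
  exact ⟨ord, by simpa [Set.injOn_univ] using hinj, fun h1 h2 h3 h4 h5 =>
    hord _ (Finset.mem_univ _) _ (Finset.mem_univ _) _ (Finset.mem_univ _) h1 h2 h3 h4 h5⟩

open Classical in
/-- The vertex `v` together with its later neighbours. -/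
noncomputable def laterClique {V : Type u} [Fintype V] (G : SimpleGraph V) (ord : V → ℕ) (v : V) :
    Finset V :=
  univ.filter fun b => ord v ≤ ord b ∧ (b = v ∨ G.Adj v b)

theorem mem_laterClique {V : Type u} [Fintype V] {G : SimpleGraph V} {ord : V → ℕ} {v b : V} :
    b ∈ laterClique G ord v ↔ ord v ≤ ord b ∧ (b = v ∨ G.Adj v b) := by
  simp [laterClique]

theorem IsPerfectElimination.isClique_laterClique {V : Type u} [Fintype V] {G : SimpleGraph V}
    {ord : V → ℕ} (hord : IsPerfectElimination G ord) (v : V) :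
    G.IsClique (laterClique G ord v : Set V) := by
  intro a ha b hb hab
  obtain ⟨hva, ha⟩ := mem_laterClique.1 ha
  obtain ⟨hvb, hb⟩ := mem_laterClique.1 hb
  rcases ha with rfl | ha
  · exact hb.resolve_left hab.symm
  · rcases hb with rfl | hb
    · exact ha.symm
    · exact hord.adj (hva.lt_of_ne (hord.injective.ne ha.ne))
        (hvb.lt_of_ne (hord.injective.ne hb.ne)) ha hb hab

/-! ### Convex combinations of conflict-free sets -/

/-- Greedy colouring along an elimination scheme: if the elements can be removed one by one so
that the remaining elements in conflict with the removed one are pairwise in conflict and of total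
weight at most one, then the weight vector is a convex combination of the incidence vectors of the
conflict-free sets. -/
theorem mem_convexHull_independent {I : Type u} [Fintype I] [DecidableEq I] (R : I → I → Prop)
    [DecidableRel R] (hrefl : ∀ i, R i i) (hsymm : ∀ i j, R i j → R j i) (w : I → ℝ)
    (hw : ∀ i, 0 ≤ w i)
    (h : ∀ T : Finset I, T.Nonempty → ∃ i ∈ T,
      (∀ j ∈ T, ∀ k ∈ T, R i j → R i k → R j k) ∧ ∑ j ∈ T with R i j, w j ≤ 1) :
    w ∈ convexHull ℝ {p : I → ℝ | ∃ U : Finset I, (∀ i ∈ U, ∀ j ∈ U, R i j → i = j) ∧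
      p = fun i => if i ∈ U then 1 else 0} := by
  have key : ∀ T : Finset I, (fun i => if i ∈ T then w i else 0) ∈
      convexHull ℝ {p : I → ℝ | ∃ U : Finset I, U ⊆ T ∧ (∀ i ∈ U, ∀ j ∈ U, R i j → i = j) ∧
        p = fun i => if i ∈ U then 1 else 0} := by
    intro T
    induction T using Finset.strongInduction with
    | H T ih =>
    rcases T.eq_empty_or_nonempty with rfl | hT
    · refine subset_convexHull _ _ ⟨∅, le_rfl, by simp, by simp⟩
    obtain ⟨i, hi, hclique, hle⟩ := h T hT
    have hIH := ih _ (Finset.erase_ssubset hi)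
    obtain ⟨ι, _, l, z, hl0, hl1, hz, hsum⟩ := mem_convexHull_iff_exists_fintype.1 hIH
    choose U hUT hU hzU using hz
    classical
    -- The sets of the combination for `T.erase i` to which `i` can be added. Every other set
    -- contains exactly one element in conflict with `i`, since these elements conflict pairwise; so
    -- `N` has mass one minus their weight, which is at least `w i`.
    set N : Finset ι := univ.filter fun m => ∀ j ∈ U m, ¬ R i j
    have hcoord : ∀ j, ∑ m, l m * (if j ∈ U m then 1 else 0) =
        if j ∈ T.erase i then w j else 0 := by
      intro j
      have := congrFun hsum j
      simpa [Finset.sum_apply, hzU] using this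
    have hone : ∀ m, ∑ j ∈ (T.erase i) with R i j, (if j ∈ U m then (1 : ℝ) else 0) =
        1 - if m ∈ N then 1 else 0 := by
      intro m
      by_cases hm : m ∈ N
      · rw [if_pos hm, sub_self]
        refine Finset.sum_eq_zero fun j hj => if_neg fun hjU => ?_
        exact (Finset.mem_filter.1 hm).2 j hjU (Finset.mem_filter.1 hj).2
      · rw [if_neg hm, sub_zero]
        have : ∃ j ∈ U m, R i j := by
          by_contra hcon
          push Not at hcon
          exact hm (Finset.mem_filter.2 ⟨Finset.mem_univ _, hcon⟩)
        obtain ⟨j, hjU, hij⟩ := this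
        rw [Finset.sum_eq_single_of_mem j (Finset.mem_filter.2 ⟨hUT m hjU, hij⟩), if_pos hjU]
        intro k hk hkj
        refine if_neg fun hkU => hkj ?_
        have hk' := Finset.mem_filter.1 hk
        exact hU m k hkU j hjU (hclique k (Finset.mem_of_mem_erase hk'.1) j
          (Finset.mem_of_mem_erase (hUT m hjU)) hk'.2 hij)
    have hmass : w i ≤ ∑ m ∈ N, l m := by
      have h1 : ∑ j ∈ (T.erase i) with R i j, w j = 1 - ∑ m ∈ N, l m := by
        calc ∑ j ∈ (T.erase i) with R i j, w j
            = ∑ j ∈ (T.erase i) with R i j, ∑ m, l m * (if j ∈ U m then 1 else 0) := by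
              refine Finset.sum_congr rfl fun j hj => ?_
              rw [hcoord, if_pos (Finset.mem_filter.1 hj).1]
          _ = ∑ m, l m * (1 - if m ∈ N then 1 else 0) := by
              rw [Finset.sum_comm]
              exact Finset.sum_congr rfl fun m _ => by rw [← hone, Finset.mul_sum]
          _ = 1 - ∑ m ∈ N, l m := by
              simp [mul_sub, Finset.sum_sub_distrib, hl1]
      have h2 : ∑ j ∈ T with R i j, w j = w i + ∑ j ∈ (T.erase i) with R i j, w j := by
        rw [Finset.filter_erase, Finset.add_sum_erase]
        exact Finset.mem_filter.2 ⟨hi, hrefl i⟩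
      linarith
    -- Adding `i` to the fraction `θ` of each set in `N` gives it exactly the weight `w i`; if `N`
    -- has mass zero, then `w i = 0`.
    obtain ⟨θ, hθ0, hθ1, hθ⟩ : ∃ θ : ℝ, 0 ≤ θ ∧ θ ≤ 1 ∧ θ * ∑ m ∈ N, l m = w i := by
      have hM : 0 ≤ ∑ m ∈ N, l m := Finset.sum_nonneg fun m _ => hl0 m
      rcases hM.eq_or_lt with h0 | h0
      · exact ⟨0, le_rfl, zero_le_one, by have := hw i; linarith⟩
      · exact ⟨w i / ∑ m ∈ N, l m, div_nonneg (hw i) hM, (div_le_one h0).2 hmass,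
          div_mul_cancel₀ _ h0.ne'⟩
    have hiU : ∀ m, i ∉ U m := fun m hm => Finset.notMem_erase i T (hUT m hm)
    set P := {p : I → ℝ | ∃ U : Finset I, U ⊆ T ∧ (∀ i ∈ U, ∀ j ∈ U, R i j → i = j) ∧
        p = fun i => if i ∈ U then 1 else 0}
    have hzP : ∀ m, z m ∈ convexHull ℝ P := fun m => subset_convexHull _ _
      ⟨U m, (hUT m).trans (Finset.erase_subset _ _), hU m, hzU m⟩
    have hins : ∀ m ∈ N, z m + Pi.single i 1 ∈ convexHull ℝ P := by
      intro m hm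
      have hm' := (Finset.mem_filter.1 hm).2
      refine subset_convexHull _ _ ⟨insert i (U m), ?_, ?_, ?_⟩
      · exact Finset.insert_subset hi ((hUT m).trans (Finset.erase_subset _ _))
      · intro j hj k hk hjk
        rcases Finset.mem_insert.1 hj with hj | hj <;> rcases Finset.mem_insert.1 hk with hk | hk
        · rw [hj, hk]
        · exact absurd (hj ▸ hjk) (hm' k hk)
        · exact absurd (hsymm _ _ (hk ▸ hjk)) (hm' j hj)
        · exact hU m j hj k hk hjk
      · funext j
        rw [Pi.add_apply, hzU m]
        by_cases hj : j = i
        · subst hj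
          simp [hiU m]
        · simp [hj]
    have hq : ∀ m, z m + (if m ∈ N then θ else 0) • Pi.single i 1 ∈ convexHull ℝ P := by
      intro m
      by_cases hm : m ∈ N
      · have := (convex_convexHull ℝ P) (hzP m) (hins m hm) (sub_nonneg.2 hθ1) hθ0
          (sub_add_cancel 1 θ)
        rw [if_pos hm]
        convert this using 1
        module
      · simpa [hm] using hzP m
    have hfin := (convex_convexHull ℝ P).sum_mem (t := univ) (fun m _ => hl0 m) hl1
      (fun m _ => hq m)
    convert hfin using 1
    simp only [smul_add, Finset.sum_add_distrib, hsum, smul_smul, ← Finset.sum_smul]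
    have : ∑ m, l m * (if m ∈ N then θ else 0) = w i := by
      simp only [mul_ite, mul_zero, Finset.sum_ite_mem, Finset.univ_inter]
      rw [← Finset.sum_mul, mul_comm, hθ]
    rw [this]
    funext j
    by_cases hj : j = i
    · subst hj
      simp [hi]
    · simp [hj]
  have := key univ
  simp only [Finset.mem_univ, if_true, Finset.subset_univ, true_and] at this
  exact this

/-! ### Vertices and edges as pieces, and their conflicts -/

/-- The vertex set of a vertex or an edge. -/
def piece {V : Type u} (G : SimpleGraph V) : V ⊕ G.edgeSet → Set V
  | Sum.inl v => {v}
  | Sum.inr e => {u | u ∈ (e : Sym2 V)}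

/-- Two elements of `V ⊕ E` touch if they share a vertex or are joined by an edge. -/
def Touch {V : Type u} (G : SimpleGraph V) (i j : V ⊕ G.edgeSet) : Prop :=
  ∃ a ∈ piece G i, ∃ b ∈ piece G j, a = b ∨ G.Adj a b

theorem piece_nonempty {V : Type u} (G : SimpleGraph V) (i : V ⊕ G.edgeSet) :
    (piece G i).Nonempty := by
  rcases i with v | ⟨e, he⟩
  · exact ⟨v, rfl⟩
  · induction e using Sym2.ind with
    | h a b => exact ⟨a, by simp [piece]⟩

theorem touch_refl {V : Type u} (G : SimpleGraph V) (i : V ⊕ G.edgeSet) : Touch G i i := by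
  obtain ⟨a, ha⟩ := piece_nonempty G i
  exact ⟨a, ha, a, ha, Or.inl rfl⟩

theorem touch_symm {V : Type u} (G : SimpleGraph V) (i j : V ⊕ G.edgeSet) (h : Touch G i j) :
    Touch G j i := by
  obtain ⟨a, ha, b, hb, h⟩ := h
  exact ⟨b, hb, a, ha, h.imp Eq.symm SimpleGraph.Adj.symm⟩

theorem eq_of_mem_piece {V : Type u} {G : SimpleGraph V} {i : V ⊕ G.edgeSet} {v a b : V}
    (hv : v ∈ piece G i) (ha : a ∈ piece G i) (hb : b ∈ piece G i) (hva : v ≠ a) (hvb : v ≠ b) :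
    a = b := by
  rcases i with u | ⟨e, he⟩
  · exact ha.trans hb.symm
  · induction e using Sym2.ind with
    | h c d =>
      simp only [piece, Set.mem_ofPred_eq, Sym2.mem_iff] at hv ha hb
      grind

theorem eq_inr_of_mem_piece {V : Type u} {G : SimpleGraph V} {i : V ⊕ G.edgeSet} {a b : V}
    (h : s(a, b) ∈ G.edgeSet) (ha : a ∈ piece G i) (hb : b ∈ piece G i) :
    i = Sum.inr ⟨s(a, b), h⟩ := by
  have hab : G.Adj a b := h
  rcases i with u | ⟨e, he⟩
  · exact absurd (ha.trans hb.symm) hab.ne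
  · have : e = s(a, b) := (Sym2.mem_and_mem_iff hab.ne).1 ⟨ha, hb⟩
    simp [this]

/-- The vertex `d` is the end of the piece that comes last in the ordering; the pieces are
eliminated in the order of these vertices. -/
theorem exists_last_vertex {V : Type u} {G : SimpleGraph V} {ord : V → ℕ}
    (hord : Function.Injective ord) (i : V ⊕ G.edgeSet) :
    ∃ d ∈ piece G i, ∀ a ∈ piece G i, a = d ∨ (G.Adj a d ∧ ord a < ord d) := by
  rcases i with v | ⟨e, he⟩
  · exact ⟨v, rfl, fun a ha => Or.inl ha⟩
  · induction e using Sym2.ind with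
    | h a b =>
      have hab : G.Adj a b := he
      simp only [piece, Set.mem_ofPred_eq, Sym2.mem_iff]
      rcases lt_or_gt_of_ne (hord.ne hab.ne) with h | h
      · refine ⟨b, Or.inr rfl, ?_⟩
        rintro c (rfl | rfl)
        · exact Or.inr ⟨hab, h⟩
        · exact Or.inl rfl
      · refine ⟨a, Or.inl rfl, ?_⟩
        rintro c (rfl | rfl)
        · exact Or.inl rfl
        · exact Or.inr ⟨hab.symm, h⟩

/-- An element touching one that is eliminated earlier, at the vertex `d`, meets the clique formed
by `d` and its later neighbours. -/
theorem IsPerfectElimination.exists_mem_piece {V : Type u} {G : SimpleGraph V} {ord : V → ℕ}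
    (hord : IsPerfectElimination G ord) {i j : V ⊕ G.edgeSet} {d d' : V}
    (hi : ∀ a ∈ piece G i, a = d ∨ (G.Adj a d ∧ ord a < ord d))
    (hd' : d' ∈ piece G j) (hj : ∀ a ∈ piece G j, a = d' ∨ (G.Adj a d' ∧ ord a < ord d'))
    (hdd : ord d ≤ ord d') (h : Touch G i j) :
    ∃ b ∈ piece G j, ord d ≤ ord b ∧ (b = d ∨ G.Adj d b) := by
  obtain ⟨a, ha, b, hb, hab⟩ := h
  -- If `b` comes before `d`, then `d` and `d'` are both later neighbours of `b`, so `d'` serves in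
  -- place of `b`.
  have caseA : (d = b ∨ G.Adj d b) → ∃ b ∈ piece G j, ord d ≤ ord b ∧ (b = d ∨ G.Adj d b) := by
    intro h
    by_cases hlt : ord d ≤ ord b
    · exact ⟨b, hb, hlt, h.imp_left Eq.symm⟩
    · push Not at hlt
      rcases hj b hb with h' | ⟨h', -⟩
      · subst h'
        omega
      · refine ⟨d', hd', hdd, ?_⟩
        by_cases he : d' = d
        · exact Or.inl he
        · rcases h with h | h
          · subst h
            omega
          · exact Or.inr (hord.adj hlt (hlt.trans_le hdd) h.symm h' (Ne.symm he))
  rcases hi a ha with rfl | ⟨had, hlt⟩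
  · exact caseA hab
  -- `d` is a later neighbour of `a`, hence equal or adjacent to all the others
  have later : ∀ c, ord a < ord c → G.Adj a c → d = c ∨ G.Adj d c := by
    intro c hc hac
    by_cases he : d = c
    · exact Or.inl he
    · exact Or.inr (hord.adj hlt hc had hac he)
  rcases hab with rfl | hab
  · rcases hj a hb with h' | ⟨h', -⟩
    · subst h'
      omega
    · exact ⟨d', hd', hdd, (later d' (hlt.trans_le hdd) h').imp_left Eq.symm⟩
  · rcases lt_or_gt_of_ne (hord.injective.ne hab.ne) with hlt' | hgt
    · exact caseA (later b hlt' hab)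
    -- Here `b` precedes `a`: both `a` and `d'` are later neighbours of `b`, hence adjacent, and
    -- then `d` and `d'` are later neighbours of `a`.
    · rcases hj b hb with h' | ⟨h', -⟩
      · subst h'
        omega
      · have hne : a ≠ d' := by
          rintro rfl
          omega
        have hadj := hord.adj hgt (by omega) hab.symm h' hne
        exact ⟨d', hd', hdd, (later d' (by omega) hadj).imp_left Eq.symm⟩

/-! ### Change of coordinates and the description for chordal graphs -/

open Classical in
/-- The weights on `V ⊕ E` belonging to a point: `x_v - y(δ(v))` on vertices, `y_e` on edges. -/
noncomputable def weight {V : Type u} [Fintype V] (G : SimpleGraph V) (p : Point G) :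
    V ⊕ G.edgeSet → ℝ :=
  Sum.elim (fun v => p.1 v - ∑ e ∈ delta G v, p.2 e) p.2

-- In x(K) minus the sum of y(δ(v)) over v in K, an edge is subtracted once for each end in K.
-- Adding back every edge that meets K once leaves exactly the edges of E(K) subtracted.
open Classical in
theorem sum_weight_eq {V : Type u} [Fintype V] (G : SimpleGraph V) (p : Point G)
    (K : Finset V) :
    ∑ i with ∃ a ∈ piece G i, a ∈ K, weight G p i =
      ∑ v ∈ K, p.1 v - ∑ e ∈ edgesIn G K, p.2 e := by
  have hdelta : ∑ v ∈ K, ∑ e ∈ delta G v, p.2 e =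
      ∑ e : G.edgeSet, ∑ v ∈ K, if v ∈ (e : Sym2 V) then p.2 e else 0 := by
    rw [Finset.sum_comm]
    exact Finset.sum_congr rfl fun v _ => by rw [delta, Finset.sum_filter]
  have hedge : ∀ e : G.edgeSet,
      (if ∃ a ∈ piece G (Sum.inr e), a ∈ K then p.2 e else 0) -
        ∑ v ∈ K, (if v ∈ (e : Sym2 V) then p.2 e else 0) =
      - if ∀ w ∈ (e : Sym2 V), w ∈ K then p.2 e else 0 := by
    rintro ⟨e, he⟩
    induction e using Sym2.ind with
    | h a b =>
      have hab : a ≠ b := SimpleGraph.Adj.ne he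
      have hsum : ∀ y : ℝ, ∑ v ∈ K, (if v ∈ s(a, b) then y else 0) =
          (if a ∈ K then y else 0) + if b ∈ K then y else 0 := by
        intro y
        rw [← Finset.sum_ite_eq' K a fun _ => y, ← Finset.sum_ite_eq' K b fun _ => y,
          ← Finset.sum_add_distrib]
        refine Finset.sum_congr rfl fun v _ => ?_
        by_cases h1 : v = a
        · simp [h1, hab]
        · simp [h1]
      rw [hsum]
      by_cases h1 : a ∈ K <;> by_cases h2 : b ∈ K <;> simp [piece, h1, h2]
  rw [Finset.sum_filter, Fintype.sum_sum_type]
  have h1 : ∑ v : V, (if ∃ a ∈ piece G (Sum.inl v), a ∈ K then weight G p (Sum.inl v) else 0) =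
      ∑ v ∈ K, p.1 v - ∑ v ∈ K, ∑ e ∈ delta G v, p.2 e := by
    rw [← Finset.sum_sub_distrib]
    simp [piece, weight, Finset.sum_ite_mem]
  have h2 : ∑ e : G.edgeSet, (if ∃ a ∈ piece G (Sum.inr e), a ∈ K then
      weight G p (Sum.inr e) else 0) = ∑ e : G.edgeSet,
        if ∃ a ∈ piece G (Sum.inr e), a ∈ K then p.2 e else 0 := by
    simp only [weight, Sum.elim_inr]
  have h3 := Finset.sum_congr rfl fun e (_ : e ∈ (univ : Finset G.edgeSet)) => hedge e
  rw [Finset.sum_sub_distrib, Finset.sum_neg_distrib] at h3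
  rw [h1, h2, hdelta, edgesIn, Finset.sum_filter]
  linarith

open Classical in
/-- The point of `ℝ^V × ℝ^E` belonging to weights on `V ⊕ E`, inverse to `weight`. -/
noncomputable def ofWeight {V : Type u} [Fintype V] (G : SimpleGraph V) :
    (V ⊕ G.edgeSet → ℝ) →ₗ[ℝ] Point G where
  toFun w := (fun v => w (Sum.inl v) + ∑ e ∈ delta G v, w (Sum.inr e), fun e => w (Sum.inr e))
  map_add' w w' := by
    refine Prod.ext (funext fun v => ?_) rfl
    simp only [Pi.add_apply, Prod.fst_add, Finset.sum_add_distrib]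
    ring
  map_smul' c w := by
    refine Prod.ext (funext fun v => ?_) rfl
    simp [Finset.mul_sum, mul_add]

theorem ofWeight_weight {V : Type u} [Fintype V] (G : SimpleGraph V) (p : Point G) :
    ofWeight G (weight G p) = p := by
  refine Prod.ext (funext fun v => ?_) rfl
  simp [ofWeight, weight]

-- `S` is the union of the pieces in `U`. Adjacent vertices of `S` lie in touching pieces, hence in
-- one piece: degrees are at most one, and every edge inside `S` is itself in `U`. Each vertex lies
-- in at most one piece, which gives its coordinate.
open Classical in
theorem ofWeight_indicator {V : Type u} [Fintype V] (G : SimpleGraph V)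
    (U : Finset (V ⊕ G.edgeSet)) (hU : ∀ i ∈ U, ∀ j ∈ U, Touch G i j → i = j) :
    ∃ S : Finset V, IsCoPlex G 2 S ∧
      ofWeight G (fun i => if i ∈ U then 1 else 0) = incidencePoint G S := by
  refine ⟨univ.filter fun v => ∃ i ∈ U, v ∈ piece G i, ?_, ?_⟩
  · intro v hv
    obtain ⟨-, i, hi, hvi⟩ := Finset.mem_filter.1 hv
    have hnb : ∀ w ∈ (univ.filter fun v => ∃ i ∈ U, v ∈ piece G i), G.Adj v w →
        w ∈ piece G i := by
      intro w hw hvw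
      obtain ⟨-, j, hj, hwj⟩ := Finset.mem_filter.1 hw
      rwa [hU i hi j hj ⟨v, hvi, w, hwj, Or.inr hvw⟩]
    refine Nat.lt_succ_of_le (Finset.card_le_one.2 fun a ha b hb => ?_)
    obtain ⟨ha, hva⟩ := Finset.mem_filter.1 ha
    obtain ⟨hb, hvb⟩ := Finset.mem_filter.1 hb
    exact eq_of_mem_piece hvi (hnb a ha hva) (hnb b hb hvb) hva.ne hvb.ne
  · refine Prod.ext (funext fun v => ?_) (funext fun e => ?_)
    · have hsum : (if Sum.inl v ∈ U then (1 : ℝ) else 0) +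
          ∑ e ∈ delta G v, (if (Sum.inr e : V ⊕ G.edgeSet) ∈ U then (1 : ℝ) else 0) =
          ∑ i : V ⊕ G.edgeSet, if v ∈ piece G i ∧ i ∈ U then 1 else 0 := by
        rw [Fintype.sum_sum_type, delta, Finset.sum_filter]
        congr 1
        · rw [Finset.sum_eq_single_of_mem v (Finset.mem_univ _)]
          · simp [piece]
          · intro b _ hb
            exact if_neg fun h => hb h.1.symm
        · exact Finset.sum_congr rfl fun e _ => by
            simp only [piece, Set.mem_ofPred_eq]
            by_cases h : v ∈ (e : Sym2 V) <;> simp [h]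
      change (if Sum.inl v ∈ U then (1 : ℝ) else 0) +
          ∑ e ∈ delta G v, (if (Sum.inr e : V ⊕ G.edgeSet) ∈ U then (1 : ℝ) else 0) =
          if v ∈ univ.filter (fun v => ∃ i ∈ U, v ∈ piece G i) then 1 else 0
      rw [hsum]
      simp only [Finset.mem_filter, Finset.mem_univ, true_and]
      by_cases hv : ∃ i ∈ U, v ∈ piece G i
      · rw [if_pos hv]
        obtain ⟨i, hi, hvi⟩ := hv
        rw [Finset.sum_eq_single_of_mem i (Finset.mem_univ _), if_pos ⟨hvi, hi⟩]
        intro j _ hji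
        exact if_neg fun h => hji (hU j h.2 i hi ⟨v, h.1, v, hvi, Or.inl rfl⟩)
      · rw [if_neg hv]
        exact Finset.sum_eq_zero fun i _ => if_neg fun h => hv ⟨i, h.2, h.1⟩
    · change (if (Sum.inr e : V ⊕ G.edgeSet) ∈ U then (1 : ℝ) else 0) =
        if e ∈ edgesIn G _ then 1 else 0
      congr 1
      rw [eq_iff_iff, edgesIn, Finset.mem_filter]
      constructor
      · exact fun h => ⟨Finset.mem_univ _, fun w hw =>
          Finset.mem_filter.2 ⟨Finset.mem_univ _, _, h, hw⟩⟩
      · rintro ⟨-, h⟩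
        obtain ⟨e, he⟩ := e
        induction e using Sym2.ind with
        | h a b =>
          obtain ⟨-, i, hi, hai⟩ := Finset.mem_filter.1 (h a (by simp))
          obtain ⟨-, j, hj, hbj⟩ := Finset.mem_filter.1 (h b (by simp))
          obtain rfl := hU i hi j hj ⟨a, hai, b, hbj, Or.inr he⟩
          rwa [← eq_inr_of_mem_piece he hai hbj]

/-- For chordal graphs the clique system implies membership in the polytope. -/
theorem IsChordal.mem_extendedPolytope {V : Type u} [Fintype V] {G : SimpleGraph V}
    (hG : IsChordal G) {p : Point G} (hx : ∀ v, ∑ e ∈ delta G v, p.2 e ≤ p.1 v)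
    (hy : ∀ e, 0 ≤ p.2 e)
    (hK : ∀ K, IsMaximalClique G K → ∑ v ∈ K, p.1 v - ∑ e ∈ edgesIn G K, p.2 e ≤ 1) :
    p ∈ extendedPolytope G := by
  classical
  obtain ⟨ord, hord⟩ := hG.exists_isPerfectElimination
  have hw : ∀ i, 0 ≤ weight G p i := by
    rintro (v | e)
    · exact sub_nonneg.2 (hx v)
    · exact hy e
  have hclique : ∀ K : Finset V, G.IsClique (K : Set V) →
      ∑ i with ∃ a ∈ piece G i, a ∈ K, weight G p i ≤ 1 := by
    intro K hKc
    -- By nonnegativity of the weights, the bound for a maximal clique passes to its subcliques.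
    obtain ⟨L, hKL, hL⟩ := Finite.exists_le_maximal
      (p := fun L : Finset V => G.IsClique (L : Set V)) hKc
    refine le_trans (Finset.sum_le_sum_of_subset_of_nonneg ?_ fun i _ _ => hw i)
      ((sum_weight_eq G p L).trans_le (hK L hL))
    intro i hi
    obtain ⟨-, a, ha, haK⟩ := Finset.mem_filter.1 hi
    exact Finset.mem_filter.2 ⟨Finset.mem_univ _, a, ha, hKL haK⟩
  choose last hlast hlt using fun i => exists_last_vertex (G := G) hord.injective i
  have hmem := mem_convexHull_independent (Touch G) (touch_refl G) (touch_symm G) (weight G p) hw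
    (fun T hT => by
      -- Remove the piece whose last vertex `d` is earliest. The remaining pieces touching it all
      -- meet the clique of `d` and its later neighbours, so they touch each other.
      obtain ⟨i, hi, hmin⟩ := Finset.exists_min_image T (fun i => ord (last i)) hT
      set d := last i
      have hKc := hord.isClique_laterClique d
      have hhit : ∀ j ∈ T, Touch G i j → ∃ b ∈ piece G j, b ∈ laterClique G ord d := by
        intro j hj hij
        obtain ⟨b, hb, h⟩ := hord.exists_mem_piece (hlt i) (hlast j) (hlt j) (hmin j hj) hij
        exact ⟨b, hb, mem_laterClique.2 h⟩
      refine ⟨i, hi, ?_, ?_⟩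
      · intro j hj k hk hij hik
        obtain ⟨a, ha, haK⟩ := hhit j hj hij
        obtain ⟨b, hb, hbK⟩ := hhit k hk hik
        refine ⟨a, ha, b, hb, ?_⟩
        by_cases hab : a = b
        · exact Or.inl hab
        · exact Or.inr (hKc haK hbK hab)
      · refine le_trans (Finset.sum_le_sum_of_subset_of_nonneg ?_ fun i _ _ => hw i) (hclique _ hKc)
        intro j hj
        obtain ⟨hj, hij⟩ := Finset.mem_filter.1 hj
        exact Finset.mem_filter.2 ⟨Finset.mem_univ _, hhit j hj hij⟩)
  have himg := Set.mem_image_of_mem (ofWeight G) hmem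
  rw [ofWeight_weight, LinearMap.image_convexHull] at himg
  refine convexHull_mono ?_ himg
  rintro _ ⟨_, ⟨U, hU, rfl⟩, rfl⟩
  obtain ⟨S, hS, h⟩ := ofWeight_indicator G U hU
  exact ⟨S, hS, h⟩

/-! ### Validity of the inequalities, and tight co-2-plexes -/

theorem IsCoPlex.eq_of_adj {V : Type u} {G : SimpleGraph V} {S : Finset V} (hS : IsCoPlex G 2 S)
    {v a b : V} (hv : v ∈ S) (ha : a ∈ S) (hb : b ∈ S) (hva : G.Adj v a) (hvb : G.Adj v b) :
    a = b := by
  classical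
  have h := Nat.le_of_lt_succ (hS v hv)
  refine Finset.card_le_one.1 h a (Finset.mem_filter.2 ⟨ha, hva⟩) b (Finset.mem_filter.2 ⟨hb, hvb⟩)

theorem mk_mem_edgesIn {V : Type u} [Fintype V] {G : SimpleGraph V} {W : Finset V} {a b : V}
    (h : G.Adj a b) : (⟨s(a, b), h⟩ : G.edgeSet) ∈ edgesIn G W ↔ a ∈ W ∧ b ∈ W := by
  simp [edgesIn]

theorem edge_mk_eq_iff {V : Type u} {G : SimpleGraph V} {a b c d : V} (h : G.Adj a b)
    (h' : G.Adj c d) : (⟨s(a, b), h⟩ : G.edgeSet) = ⟨s(c, d), h'⟩ ↔ s(a, b) = s(c, d) :=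
  Subtype.ext_iff

theorem IsCoPlex.delta_le {V : Type u} [Fintype V] {G : SimpleGraph V} {S : Finset V}
    (hS : IsCoPlex G 2 S) (v : V) :
    ∑ e ∈ delta G v, (incidencePoint G S).2 e ≤ (incidencePoint G S).1 v := by
  classical
  have hends : ∀ e ∈ (delta G v).filter (· ∈ edgesIn G S),
      ∃ w, ∃ h : G.Adj v w, e = ⟨s(v, w), h⟩ ∧ v ∈ S ∧ w ∈ S := by
    rintro ⟨e, he⟩ h
    simp only [delta, edgesIn, Finset.mem_filter, Finset.mem_univ, true_and] at h
    obtain ⟨w, rfl⟩ := Sym2.mem_iff_exists.1 h.1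
    exact ⟨w, he, rfl, h.2 v (by simp), h.2 w (by simp)⟩
  simp only [incidencePoint]
  rw [← Finset.sum_filter, Finset.sum_const, nsmul_eq_mul, mul_one]
  by_cases hv : v ∈ S
  · rw [if_pos hv]
    exact_mod_cast Finset.card_le_one.2 fun e he e' he' => by
      obtain ⟨w, hw, rfl, -, hwS⟩ := hends e he
      obtain ⟨w', hw', rfl, -, hwS'⟩ := hends e' he'
      simp [hS.eq_of_adj hv hwS hwS' hw hw']
  · rw [if_neg hv]
    refine le_of_eq ?_
    rw [Nat.cast_eq_zero, Finset.card_eq_zero, Finset.eq_empty_iff_forall_notMem]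
    intro e he
    obtain ⟨w, hw, -, hvS, -⟩ := hends e he
    exact hv hvS

theorem incidencePoint_snd_nonneg {V : Type u} [Fintype V] (G : SimpleGraph V) (S : Finset V)
    (e : G.edgeSet) : 0 ≤ (incidencePoint G S).2 e := by
  simp only [incidencePoint]
  split_ifs <;> norm_num

/-- A co-2-plex meets a clique in at most two vertices, and if in two, the edge joining them is
subtracted. -/
theorem IsCoPlex.clique_le {V : Type u} [Fintype V] {G : SimpleGraph V} {S : Finset V}
    (hS : IsCoPlex G 2 S) {K : Finset V} (hK : G.IsClique (K : Set V)) :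
    ∑ v ∈ K, (incidencePoint G S).1 v - ∑ e ∈ edgesIn G K, (incidencePoint G S).2 e ≤ 1 := by
  classical
  have hx : ∑ v ∈ K, (incidencePoint G S).1 v = ((K ∩ S).card : ℝ) := by
    simp [incidencePoint, Finset.sum_ite_mem]
  have hy : 0 ≤ ∑ e ∈ edgesIn G K, (incidencePoint G S).2 e :=
    Finset.sum_nonneg fun e _ => incidencePoint_snd_nonneg G S e
  rw [hx]
  by_cases h1 : (K ∩ S).card ≤ 1
  · have : ((K ∩ S).card : ℝ) ≤ 1 := by exact_mod_cast h1
    linarith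
  · obtain ⟨a, ha, b, hb, hab⟩ := Finset.one_lt_card.1 (not_le.1 h1)
    obtain ⟨haK, haS⟩ := Finset.mem_inter.1 ha
    obtain ⟨hbK, hbS⟩ := Finset.mem_inter.1 hb
    have hadj : G.Adj a b := hK haK hbK hab
    have hcard : (K ∩ S).card ≤ 2 := by
      refine (Finset.card_le_card (t := {a, b}) fun c hc => ?_).trans Finset.card_le_two
      obtain ⟨hcK, hcS⟩ := Finset.mem_inter.1 hc
      rw [Finset.mem_insert, Finset.mem_singleton]
      by_cases hca : c = a
      · exact Or.inl hca
      · exact Or.inr (hS.eq_of_adj haS hcS hbS (hK haK hcK (Ne.symm hca)) hadj)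
    have hone : 1 ≤ ∑ e ∈ edgesIn G K, (incidencePoint G S).2 e := by
      refine le_trans (le_of_eq ?_) (Finset.single_le_sum
        (fun e _ => incidencePoint_snd_nonneg G S e) ((mk_mem_edgesIn hadj).2 ⟨haK, hbK⟩))
      exact (if_pos ((mk_mem_edgesIn hadj).2 ⟨haS, hbS⟩)).symm
    have : ((K ∩ S).card : ℝ) ≤ 2 := by exact_mod_cast hcard
    linarith

/-- The coordinate `x_v` as a linear functional. -/
def xCoord {V : Type u} (G : SimpleGraph V) (v : V) : Point G →ₗ[ℝ] ℝ :=
  LinearMap.proj v ∘ₗ LinearMap.fst ℝ _ _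

/-- The coordinate `y_e` as a linear functional. -/
def yCoord {V : Type u} (G : SimpleGraph V) (e : G.edgeSet) : Point G →ₗ[ℝ] ℝ :=
  LinearMap.proj e ∘ₗ LinearMap.snd ℝ _ _

@[simp]
theorem xCoord_apply {V : Type u} (G : SimpleGraph V) (v : V) (p : Point G) :
    xCoord G v p = p.1 v := rfl

@[simp]
theorem yCoord_apply {V : Type u} (G : SimpleGraph V) (e : G.edgeSet) (p : Point G) :
    yCoord G e p = p.2 e := rfl

theorem le_of_mem_convexHull {E : Type*} [AddCommGroup E] [Module ℝ E] {Q : Set E} {p : E}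
    (hp : p ∈ convexHull ℝ Q) (f : E →ₗ[ℝ] ℝ) {c : ℝ} (h : ∀ q ∈ Q, f q ≤ c) : f p ≤ c :=
  convexHull_min (t := {x | f x ≤ c}) h (convex_halfSpace_le f.isLinear c) hp

/-- A point of a convex hull forces a generator that is tight in every valid inequality which is
tight at the point. -/
theorem exists_tight_of_mem_convexHull {E : Type*} [AddCommGroup E] [Module ℝ E] {Q : Set E}
    {p : E} (hp : p ∈ convexHull ℝ Q) :
    ∃ q ∈ Q, ∀ (f : E →ₗ[ℝ] ℝ) (c : ℝ), (∀ q' ∈ Q, f q' ≤ c) → f p = c → f q = c := by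
  obtain ⟨ι, _, w, z, hw0, hw1, hz, rfl⟩ := mem_convexHull_iff_exists_fintype.1 hp
  obtain ⟨i, hi⟩ : ∃ i, 0 < w i := by
    by_contra hcon
    push Not at hcon
    have := Finset.sum_nonpos fun i (_ : i ∈ (univ : Finset ι)) => hcon i
    linarith
  refine ⟨z i, hz i, fun f c hf hc => ?_⟩
  -- The slacks of the generators are nonnegative and average to zero, so a generator of positive
  -- weight has slack zero.
  have hsum : ∑ j, w j * (c - f (z j)) = 0 := by
    have : ∑ j, w j * f (z j) = c := by simpa [map_sum] using hc
    simp [mul_sub, Finset.sum_sub_distrib, ← Finset.sum_mul, hw1, this]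
  have h0 := (Finset.sum_eq_zero_iff_of_nonneg fun j _ =>
    mul_nonneg (hw0 j) (sub_nonneg.2 (hf _ (hz j)))).1 hsum i (Finset.mem_univ i)
  rcases mul_eq_zero.1 h0 with h | h
  · exact absurd h hi.ne'
  · linarith

/-- The inequalities of the clique system are valid for the polytope, for all graphs. -/
theorem valid_of_mem_extendedPolytope {V : Type u} [Fintype V] {G : SimpleGraph V} {p : Point G}
    (hp : p ∈ extendedPolytope G) :
    (∀ v, ∑ e ∈ delta G v, p.2 e ≤ p.1 v) ∧ (∀ e, 0 ≤ p.2 e) ∧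
      ∀ K, IsMaximalClique G K → ∑ v ∈ K, p.1 v - ∑ e ∈ edgesIn G K, p.2 e ≤ 1 := by
  refine ⟨fun v => ?_, fun e => ?_, fun K hK => ?_⟩
  · have := le_of_mem_convexHull hp (∑ e ∈ delta G v, yCoord G e - xCoord G v) (c := 0) (by
      rintro _ ⟨S, hS, rfl⟩
      simpa using hS.delta_le v)
    simpa using this
  · have := le_of_mem_convexHull hp (-yCoord G e) (c := 0) (by
      rintro _ ⟨S, hS, rfl⟩
      simpa using incidencePoint_snd_nonneg G S e)
    simpa using this
  · have := le_of_mem_convexHull hp (∑ v ∈ K, xCoord G v - ∑ e ∈ edgesIn G K, yCoord G e)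
      (c := 1) (by
        rintro _ ⟨S, hS, rfl⟩
        simpa using hS.clique_le hK.prop)
    simpa using this

/-- A co-2-plex that is tight in all the inequalities used in the non-chordal case. -/
theorem exists_tight_coPlex {V : Type u} [Fintype V] {G : SimpleGraph V} {p : Point G}
    (hp : p ∈ extendedPolytope G) : ∃ S : Finset V, IsCoPlex G 2 S ∧
      (∀ a b (h : G.Adj a b), p.1 a + p.1 b - p.2 ⟨s(a, b), h⟩ = 1 → a ∈ S ∨ b ∈ S) ∧
      (∀ a b (h : G.Adj a b), p.2 ⟨s(a, b), h⟩ = 0 → ¬ (a ∈ S ∧ b ∈ S)) ∧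
      ∀ v, ∑ e ∈ delta G v, p.2 e = p.1 v → v ∈ S →
        ∃ w, ∃ h : G.Adj v w, w ∈ S ∧ p.2 ⟨s(v, w), h⟩ ≠ 0 := by
  classical
  obtain ⟨_, ⟨S, hS, rfl⟩, hq⟩ := exists_tight_of_mem_convexHull hp
  have hzero : ∀ e, p.2 e = 0 → (incidencePoint G S).2 e = 0 := by
    intro e h
    have := hq (-yCoord G e) 0 (by
      rintro _ ⟨T, hT, rfl⟩
      simpa using incidencePoint_snd_nonneg G T e) (by simpa using h)
    simpa using this
  refine ⟨S, hS, fun a b h hp1 => ?_, fun a b h hp0 hab => ?_, fun v hv hvS => ?_⟩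
  -- This edge inequality is valid for every co-2-plex, whether or not the edge is a maximal clique.
  · have := hq (xCoord G a + xCoord G b - yCoord G ⟨s(a, b), h⟩) 1 (by
      rintro _ ⟨T, hT, rfl⟩
      by_cases h1 : a ∈ T <;> by_cases h2 : b ∈ T <;>
        simp [incidencePoint, mk_mem_edgesIn, h1, h2]) (by simpa using hp1)
    by_contra hcon
    push Not at hcon
    simp [incidencePoint, mk_mem_edgesIn, hcon.1, hcon.2] at this
  · have := hzero _ hp0
    simp [incidencePoint, mk_mem_edgesIn, hab.1, hab.2] at this
  · have h1 := hq (∑ e ∈ delta G v, yCoord G e - xCoord G v) 0 (by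
      rintro _ ⟨T, hT, rfl⟩
      simpa using hT.delta_le v) (by simpa [sub_eq_zero] using hv)
    have h2 : ∑ e ∈ delta G v, (incidencePoint G S).2 e = 1 := by
      have h3 : (incidencePoint G S).1 v = 1 := if_pos hvS
      simp only [LinearMap.sub_apply, LinearMap.sum_apply, yCoord_apply, xCoord_apply, h3] at h1
      linarith
    obtain ⟨⟨e, he⟩, hev, hne⟩ := Finset.exists_ne_zero_of_sum_ne_zero (h2.trans_ne one_ne_zero)
    obtain ⟨w, rfl⟩ := Sym2.mem_iff_exists.1 (Finset.mem_filter.1 hev).2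
    refine ⟨w, he, ?_, fun h => hne (hzero _ h)⟩
    by_contra hw
    exact hne (by simp [incidencePoint, mk_mem_edgesIn (show G.Adj v w from he), hw])

/-! ### Holes: a point outside the polytope -/

open Classical in
/-- The point used to separate: `1/2` on the vertices of `R`, to which the vector with value
`ε / 2` on the vertex `b` and on two edges is added. -/
noncomputable def holePoint {V : Type u} (G : SimpleGraph V) (R : Finset V) (b : V)
    (e₀ e₁ : G.edgeSet) (ε : ℝ) : Point G :=
  (fun v => (if v ∈ R then 1 / 2 else 0) + if v = b then ε / 2 else 0,
    fun e => (if e = e₀ then ε / 2 else 0) + if e = e₁ then ε / 2 else 0)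

theorem sum_delta_holePoint {V : Type u} [Fintype V] {G : SimpleGraph V} (R : Finset V) (b : V)
    (e₀ e₁ : G.edgeSet) (ε : ℝ) (v : V) [Decidable (v ∈ (e₀ : Sym2 V))]
    [Decidable (v ∈ (e₁ : Sym2 V))] :
    ∑ e ∈ delta G v, (holePoint G R b e₀ e₁ ε).2 e =
      (if v ∈ (e₀ : Sym2 V) then ε / 2 else 0) + if v ∈ (e₁ : Sym2 V) then ε / 2 else 0 := by
  classical
  simp only [holePoint, Finset.sum_add_distrib, Finset.sum_ite_eq', delta, Finset.mem_filter,
    Finset.mem_univ, true_and]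

/-- A clique has at most two vertices in `R`, so the halves sum to at most 1. The extra `ε / 2` at
`b` is cancelled by an edge when the clique contains `a` or `d`; otherwise `b` is its only vertex in
`R`, and `1 / 2 + ε / 2 ≤ 1`. -/
theorem holePoint_valid {V : Type u} [Fintype V] {G : SimpleGraph V} {R : Finset V} {a b d : V}
    (hab : G.Adj a b) (hbd : G.Adj b d) (had : a ≠ d) (haR : a ∈ R) (hbR : b ∈ R) (hdR : d ∈ R)
    (hR : ∀ K : Finset V, G.IsClique (K : Set V) → K ⊆ R → K.card ≤ 2)
    (hb : ∀ v ∈ R, G.Adj b v → v = a ∨ v = d) {ε : ℝ} (h0 : 0 ≤ ε) (h1 : ε ≤ 1) :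
    (∀ v, ∑ e ∈ delta G v, (holePoint G R b ⟨s(a, b), hab⟩ ⟨s(b, d), hbd⟩ ε).2 e ≤
        (holePoint G R b ⟨s(a, b), hab⟩ ⟨s(b, d), hbd⟩ ε).1 v) ∧
      (∀ e, 0 ≤ (holePoint G R b ⟨s(a, b), hab⟩ ⟨s(b, d), hbd⟩ ε).2 e) ∧
      ∀ K, IsMaximalClique G K →
        ∑ v ∈ K, (holePoint G R b ⟨s(a, b), hab⟩ ⟨s(b, d), hbd⟩ ε).1 v -
          ∑ e ∈ edgesIn G K, (holePoint G R b ⟨s(a, b), hab⟩ ⟨s(b, d), hbd⟩ ε).2 e ≤ 1 := by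
  classical
  refine ⟨fun v => ?_, fun e => ?_, fun K hK => ?_⟩
  · rw [sum_delta_holePoint]
    simp only [holePoint, Sym2.mem_iff]
    by_cases hva : v = a
    · subst hva
      simp [haR, hab.ne, had]
      linarith
    · by_cases hvb : v = b
      · subst hvb
        simp [hbR]
        linarith
      · by_cases hvd : v = d
        · subst hvd
          simp [hva, hvb, hdR]
          linarith
        · simp only [hva, hvb, hvd, or_self, if_false, add_zero]
          split_ifs <;> norm_num
  · simp only [holePoint]
    split_ifs <;> linarith
  · have hKc : G.IsClique (K : Set V) := hK.prop
    have hx : ∑ v ∈ K, (holePoint G R b ⟨s(a, b), hab⟩ ⟨s(b, d), hbd⟩ ε).1 v =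
        ((K ∩ R).card : ℝ) / 2 + if b ∈ K then ε / 2 else 0 := by
      simp [holePoint, Finset.sum_add_distrib, Finset.sum_ite_mem, div_eq_mul_inv]
    have hy : ∑ e ∈ edgesIn G K, (holePoint G R b ⟨s(a, b), hab⟩ ⟨s(b, d), hbd⟩ ε).2 e =
        (if a ∈ K ∧ b ∈ K then ε / 2 else 0) + if b ∈ K ∧ d ∈ K then ε / 2 else 0 := by
      simp only [holePoint, Finset.sum_add_distrib, Finset.sum_ite_eq', mk_mem_edgesIn]
    rw [hx, hy]
    have hcard : (K ∩ R).card ≤ 2 := hR _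
      (hKc.subset (by exact_mod_cast Finset.inter_subset_left)) Finset.inter_subset_right
    have hcard' : ((K ∩ R).card : ℝ) ≤ 2 := by exact_mod_cast hcard
    by_cases hbK : b ∈ K
    · by_cases hadK : a ∈ K ∨ d ∈ K
      · rcases hadK with h | h
        · have : 0 ≤ if d ∈ K then ε / 2 else 0 := by split_ifs <;> linarith
          simp only [hbK, h, true_and, and_self, if_true]
          linarith
        · have : 0 ≤ if a ∈ K then ε / 2 else 0 := by split_ifs <;> linarith
          simp only [hbK, h, and_true, and_self, if_true]
          linarith
      · push Not at hadK
        have : (K ∩ R).card ≤ 1 := by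
          refine (Finset.card_le_card (t := {b}) fun c hc => ?_).trans (by simp)
          obtain ⟨hcK, hcR⟩ := Finset.mem_inter.1 hc
          rw [Finset.mem_singleton]
          by_contra hcb
          rcases hb c hcR (hKc hbK hcK (Ne.symm hcb)) with rfl | rfl
          · exact hadK.1 hcK
          · exact hadK.2 hcK
        have : ((K ∩ R).card : ℝ) ≤ 1 := by exact_mod_cast this
        simp only [hbK, hadK.1, hadK.2, false_and, and_false, if_true, if_false]
        linarith
    · simp only [hbK, false_and, and_false, if_false]
      linarith

theorem alternating_iff {P : ℕ → Prop} {m n : ℕ}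
    (h : ∀ i, m ≤ i → i + 1 < n → (P (i + 1) ↔ ¬ P i)) (k : ℕ) (hk : m + k < n) :
    P (m + k) ↔ (P m ↔ k % 2 = 0) := by
  induction k with
  | zero => simp
  | succ k ih =>
    have h1 := ih (by omega)
    have h2 := h (m + k) (by omega) (by omega)
    have h3 : (k + 1) % 2 = 0 ↔ ¬ k % 2 = 0 := by omega
    rw [← add_assoc, h2, h1, h3]
    tauto

/-- If the clique system describes the polytope, then there is no hole. -/
theorem isChordal_of_forall_mem_extendedPolytope {V : Type u} [Fintype V] {G : SimpleGraph V}
    (h : ∀ p : Point G, (∀ v, ∑ e ∈ delta G v, p.2 e ≤ p.1 v) → (∀ e, 0 ≤ p.2 e) →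
      (∀ K, IsMaximalClique G K → ∑ v ∈ K, p.1 v - ∑ e ∈ edgesIn G K, p.2 e ≤ 1) →
      p ∈ extendedPolytope G) : IsChordal G := by
  classical
  intro n hn
  refine ⟨fun f => ?_⟩
  have hadj : ∀ i j (hi : i < n) (hj : j < n), G.Adj (f ⟨i, hi⟩) (f ⟨j, hj⟩) ↔
      j = i + 1 ∨ i = j + 1 ∨ (i = 0 ∧ j + 1 = n) ∨ (j = 0 ∧ i + 1 = n) := by
    intro i j hi hj
    rw [f.map_rel_iff, cycleGraph_adj_iff_val (by omega)]
  have hinj : ∀ i j (hi : i < n) (hj : j < n), f ⟨i, hi⟩ = f ⟨j, hj⟩ ↔ i = j := by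
    intro i j hi hj
    rw [f.injective.eq_iff, Fin.mk.injEq]
  -- Reduction modulo `n` only makes `c` total; all adjacencies are used for indices below `n`.
  set c : ℕ → V := fun i => f ⟨i % n, Nat.mod_lt _ (by omega)⟩ with hc
  have hcadj : ∀ i j, i < n → j < n → (G.Adj (c i) (c j) ↔
      j = i + 1 ∨ i = j + 1 ∨ (i = 0 ∧ j + 1 = n) ∨ (j = 0 ∧ i + 1 = n)) := by
    intro i j hi hj
    rw [hc]
    dsimp only
    rw [hadj, Nat.mod_eq_of_lt hi, Nat.mod_eq_of_lt hj]
  have hcinj : ∀ i j, i < n → j < n → (c i = c j ↔ i = j) := by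
    intro i j hi hj
    rw [hc]
    dsimp only
    rw [hinj, Nat.mod_eq_of_lt hi, Nat.mod_eq_of_lt hj]
  set R : Finset V := (Finset.range n).image c
  have hcR : ∀ i, i < n → c i ∈ R := fun i hi =>
    Finset.mem_image_of_mem c (Finset.mem_range.2 hi)
  have h01 : G.Adj (c 0) (c 1) := (hcadj 0 1 (by omega) (by omega)).2 (by omega)
  have h12 : G.Adj (c 1) (c 2) := (hcadj 1 2 (by omega) (by omega)).2 (by omega)
  have h02 : c 0 ≠ c 2 := fun h => by
    have := (hcinj 0 2 (by omega) (by omega)).1 h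
    omega
  have hRclique : ∀ K : Finset V, G.IsClique (K : Set V) → K ⊆ R → K.card ≤ 2 := by
    intro K hK hKR
    by_contra hcon
    obtain ⟨x, hx, y, hy, z, hz, hxy, hxz, hyz⟩ := Finset.two_lt_card.1 (not_le.1 hcon)
    have hxy := hK hx hy hxy
    have hxz := hK hx hz hxz
    have hyz := hK hy hz hyz
    obtain ⟨i, hi, rfl⟩ := Finset.mem_image.1 (hKR hx)
    obtain ⟨j, hj, rfl⟩ := Finset.mem_image.1 (hKR hy)
    obtain ⟨k, hk, rfl⟩ := Finset.mem_image.1 (hKR hz)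
    rw [Finset.mem_range] at hi hj hk
    rw [hcadj _ _ hi hj] at hxy
    rw [hcadj _ _ hi hk] at hxz
    rw [hcadj _ _ hj hk] at hyz
    omega
  have hnb : ∀ v ∈ R, G.Adj (c 1) v → v = c 0 ∨ v = c 2 := by
    intro v hv hadj
    obtain ⟨i, hi, rfl⟩ := Finset.mem_image.1 hv
    rw [Finset.mem_range] at hi
    rw [hcadj 1 i (by omega) hi] at hadj
    have : i = 0 ∨ i = 2 := by omega
    rcases this with rfl | rfl
    · exact Or.inl rfl
    · exact Or.inr rfl
  set pt : ℝ → Point G := fun ε => holePoint G R (c 1) ⟨s(c 0, c 1), h01⟩ ⟨s(c 1, c 2), h12⟩ ε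
    with hpt
  have hmem : ∀ ε : ℝ, 0 ≤ ε → ε ≤ 1 → pt ε ∈ extendedPolytope G := by
    intro ε h0 h1
    obtain ⟨v1, v2, v3⟩ := holePoint_valid h01 h12 h02 (hcR 0 (by omega)) (hcR 1 (by omega))
      (hcR 2 (by omega)) hRclique hnb h0 h1
    exact h _ v1 v2 v3
  have hx : ∀ ε i, i < n → (pt ε).1 (c i) = 1 / 2 + if i = 1 then ε / 2 else 0 := by
    intro ε i hi
    simp only [hpt, holePoint, hcR i hi, if_true, hcinj i 1 hi (by omega)]
  have hy : ∀ ε v w (hvw : G.Adj v w), (pt ε).2 ⟨s(v, w), hvw⟩ =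
      (if s(v, w) = s(c 0, c 1) then ε / 2 else 0) +
        if s(v, w) = s(c 1, c 2) then ε / 2 else 0 := by
    intro ε v w hvw
    simp only [hpt, holePoint, edge_mk_eq_iff]
  have hlast : G.Adj (c (n - 1)) (c 0) := (hcadj _ _ (by omega) (by omega)).2 (by omega)
  rcases Nat.even_or_odd n with heven | hodd
  -- Even hole, `ε = 1`. Tightness makes `S` alternate along the path from `c 2` through `c (n - 1)`
  -- to `c 0`, which has an odd number of vertices, so `c 0` and `c 2` are both in `S` or both
  -- outside.
  · obtain ⟨S, hS, hcov, hpair, hdelta⟩ := exists_tight_coPlex (hmem 1 zero_le_one le_rfl)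
    have hyz : ∀ i j (hi : i < n) (hj : j < n) (hij : G.Adj (c i) (c j)), i ≠ 1 → j ≠ 1 →
        (pt 1).2 ⟨s(c i, c j), hij⟩ = 0 := by
      intro i j hi hj hij hi1 hj1
      have e1 : ¬ s(c i, c j) = s(c 0, c 1) := by
        rw [Sym2.eq_iff, hcinj _ _ hi (by omega), hcinj _ _ hj (by omega),
          hcinj _ _ hi (by omega), hcinj _ _ hj (by omega)]
        omega
      have e2 : ¬ s(c i, c j) = s(c 1, c 2) := by
        rw [Sym2.eq_iff, hcinj _ _ hi (by omega), hcinj _ _ hj (by omega),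
          hcinj _ _ hi (by omega), hcinj _ _ hj (by omega)]
        omega
      rw [hy, if_neg e1, if_neg e2, add_zero]
    have hstep : ∀ i j (hi : i < n) (hj : j < n) (hij : G.Adj (c i) (c j)), i ≠ 1 → j ≠ 1 →
        (c j ∈ S ↔ ¬ c i ∈ S) := by
      intro i j hi hj hij hi1 hj1
      refine ⟨fun h h' => hpair _ _ hij (hyz i j hi hj hij hi1 hj1) ⟨h', h⟩,
        (hcov _ _ hij ?_).resolve_left⟩
      rw [hyz i j hi hj hij hi1 hj1, hx _ i hi, hx _ j hj, if_neg hi1, if_neg hj1]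
      norm_num
    have halt := alternating_iff (P := fun i => c i ∈ S) (m := 2) (fun i hi hi' =>
      hstep i (i + 1) (by omega) hi' ((hcadj _ _ (by omega) hi').2 (by omega)) (by omega)
        (by omega)) (n - 3) (by omega)
    have hpar : ¬ (n - 3) % 2 = 0 := by
      obtain ⟨m, hm⟩ := heven
      omega
    have hl := hstep (n - 1) 0 (by omega) (by omega) hlast (by omega) (by omega)
    rw [show 2 + (n - 3) = n - 1 by omega] at halt
    simp only [hpar, iff_false] at halt
    rw [halt, not_not] at hl
    have hmid : ∀ w (hvw : G.Adj (c 1) w), (pt 1).2 ⟨s(c 1, w), hvw⟩ ≠ 0 → w = c 0 ∨ w = c 2 := by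
      intro w hvw hne
      rw [hy] at hne
      by_contra hcon
      push Not at hcon
      refine hne ?_
      have n1 : c 1 ≠ c 0 := h01.ne'
      have n2 : c 1 ≠ c 2 := h12.ne
      simp [hcon.1, hcon.2, n1, n2]
    have hdelta_c : ∀ i, i < n → i ≤ 2 → ∑ e ∈ delta G (c i), (pt 1).2 e = (pt 1).1 (c i) := by
      intro i hi hi2
      rw [hx _ i hi]
      simp only [hpt]
      rw [sum_delta_holePoint]
      simp only [Sym2.mem_iff, hcinj i _ hi (show 0 < n by omega),
        hcinj i _ hi (show 1 < n by omega), hcinj i _ hi (show 2 < n by omega)]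
      interval_cases i <;> norm_num
    have hzero : c 0 ∈ S → c 1 ∈ S := by
      intro h0
      obtain ⟨w, hw, hwS, hne⟩ := hdelta (c 0) (hdelta_c 0 (by omega) (by omega)) h0
      by_contra h1
      refine hne ?_
      have hw1 : w ≠ c 1 := fun h => h1 (h ▸ hwS)
      have n1 : c 0 ≠ c 1 := h01.ne
      rw [hy]
      simp [hw1, n1, h02]
    -- If both are in `S`, tightness at `c 0` forces `c 1` into `S`, where it has two neighbours. If
    -- neither is, the edge from `c 0` to `c 1` forces `c 1` into `S`, and tightness at `c 1`
    -- demands one of them.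
    by_cases h0 : c 0 ∈ S
    · have h2 : c 2 ∈ S := hl.1 h0
      exact h02 (hS.eq_of_adj (hzero h0) h0 h2 h01.symm h12)
    · have h2 : c 2 ∉ S := fun h => h0 (hl.2 h)
      have h1 : c 1 ∈ S := by
        refine (hcov _ _ h01 ?_).resolve_left h0
        have e2 : ¬ s(c 0, c 1) = s(c 1, c 2) := by
          rw [Sym2.eq_iff]
          rintro (⟨h, -⟩ | ⟨h, -⟩)
          · exact h01.ne h
          · exact h02 h
        rw [hy, hx _ 0 (by omega), hx _ 1 (by omega), if_pos rfl, if_neg e2]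
        norm_num
      obtain ⟨w, hw, hwS, hne⟩ := hdelta (c 1) (hdelta_c 1 (by omega) (by omega)) h1
      rcases hmid w hw hne with rfl | rfl
      · exact h0 hwS
      · exact h2 hwS
  -- Odd hole, `ε = 0`: all hole edges are tight with y-value zero, so `S` would alternate around an
  -- odd cycle.
  · obtain ⟨S, hS, hcov, hpair, -⟩ := exists_tight_coPlex (hmem 0 le_rfl zero_le_one)
    have hstep : ∀ i j (hi : i < n) (hj : j < n) (hij : G.Adj (c i) (c j)),
        (c j ∈ S ↔ ¬ c i ∈ S) := by
      intro i j hi hj hij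
      have hy0 : (pt 0).2 ⟨s(c i, c j), hij⟩ = 0 := by
        rw [hy]
        simp
      refine ⟨fun h h' => hpair _ _ hij hy0 ⟨h', h⟩, (hcov _ _ hij ?_).resolve_left⟩
      rw [hy0, hx _ i hi, hx _ j hj]
      norm_num
    have halt := alternating_iff (P := fun i => c i ∈ S) (m := 0) (fun i hi hi' =>
      hstep i (i + 1) (by omega) hi' ((hcadj _ _ (by omega) hi').2 (by omega))) (n - 1) (by omega)
    have hpar : (n - 1) % 2 = 0 := by
      obtain ⟨m, hm⟩ := hodd
      omega
    have hl := hstep (n - 1) 0 (by omega) (by omega) hlast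
    simp only [zero_add, hpar, iff_true] at halt
    exact iff_not_self (hl.trans (not_congr halt))

/-! ### Size of the linear system -/

theorem bitSize_le_two {z : ℤ} (h : z.natAbs ≤ 1) : bitSize z ≤ 2 := by
  have : z.natAbs.size ≤ 1 := Nat.size_le.2 (by omega)
  unfold bitSize
  omega

-- A nonempty maximal clique consists of its earliest vertex and the later neighbours of that
-- vertex. The extra 1 accounts for the empty clique, which is maximal when there are no vertices.
open Classical in
theorem IsPerfectElimination.card_maximalClique_le {V : Type u} [Fintype V] {G : SimpleGraph V}
    {ord : V → ℕ} (hord : IsPerfectElimination G ord) :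
    (univ.filter (IsMaximalClique G)).card ≤ Fintype.card V + 1 := by
  have hsub : univ.filter (IsMaximalClique G) ⊆ insert ∅ (univ.image (laterClique G ord)) := by
    intro K hK
    have hK : Maximal (fun L : Finset V => G.IsClique (L : Set V)) K := (Finset.mem_filter.1 hK).2
    rcases K.eq_empty_or_nonempty with rfl | hne
    · exact Finset.mem_insert_self _ _
    · obtain ⟨v, hv, hmin⟩ := Finset.exists_min_image K ord hne
      refine Finset.mem_insert_of_mem (Finset.mem_image.2 ⟨v, Finset.mem_univ _, ?_⟩)
      refine (hK.eq_of_le (hord.isClique_laterClique v) fun b hb => ?_).symm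
      refine mem_laterClique.2 ⟨hmin b hb, ?_⟩
      by_cases hbv : b = v
      · exact Or.inl hbv
      · exact Or.inr (hK.prop hv hb (Ne.symm hbv))
  calc _ ≤ _ := Finset.card_le_card hsub
    _ ≤ (univ.image (laterClique G ord)).card + 1 := Finset.card_insert_le _ _
    _ ≤ Fintype.card V + 1 := Nat.add_le_add_right Finset.card_image_le 1

theorem natAbs_le_one_of_mem_cliqueSystem {V : Type u} [Fintype V] {G : SimpleGraph V}
    {I : LinIneq G} (hI : I ∈ cliqueSystem G) :
    (∀ v, (I.a v).natAbs ≤ 1) ∧ (∀ e, (I.b e).natAbs ≤ 1) ∧ I.c.natAbs ≤ 1 := by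
  classical
  simp only [cliqueSystem, Finset.mem_union, Finset.mem_image] at hI
  rcases hI with (⟨v, -, rfl⟩ | ⟨e, -, rfl⟩) | ⟨K, -, rfl⟩
  · refine ⟨fun w => ?_, fun e => ?_, ?_⟩ <;> simp only [deltaIneq] <;> (try split_ifs) <;> simp
  · refine ⟨fun w => ?_, fun e => ?_, ?_⟩ <;> simp only [nonnegIneq] <;> (try split_ifs) <;> simp
  · refine ⟨fun w => ?_, fun e => ?_, ?_⟩ <;> simp only [cliqueIneq] <;> (try split_ifs) <;> simp

open Classical in
theorem card_edgeSet_le {V : Type u} [Fintype V] (G : SimpleGraph V) :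
    Fintype.card G.edgeSet ≤ Fintype.card V ^ 2 := by
  calc Fintype.card G.edgeSet ≤ Fintype.card (Sym2 V) :=
        Fintype.card_le_of_injective _ Subtype.val_injective
    _ ≤ Fintype.card (V × V) := Fintype.card_le_of_surjective _ Quot.mk_surjective
    _ = Fintype.card V ^ 2 := by rw [Fintype.card_prod, sq]

/-- A polynomial bound for the encoding length of the clique system of a chordal graph. -/
theorem IsChordal.encodingSize_le {V : Type u} [Fintype V] {G : SimpleGraph V}
    (hG : IsChordal G) : encodingSize (cliqueSystem G) ≤
      (Fintype.card V + Fintype.card V ^ 2 + (Fintype.card V + 1)) *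
        (2 * Fintype.card V + 2 * Fintype.card V ^ 2 + 2) := by
  classical
  obtain ⟨ord, hord⟩ := hG.exists_isPerfectElimination
  have hcard : (cliqueSystem G).card ≤
      Fintype.card V + Fintype.card V ^ 2 + (Fintype.card V + 1) := by
    unfold cliqueSystem
    refine (Finset.card_union_le _ _).trans (Nat.add_le_add
      ((Finset.card_union_le _ _).trans (Nat.add_le_add Finset.card_image_le
        (Finset.card_image_le.trans ?_))) (Finset.card_image_le.trans hord.card_maximalClique_le))
    exact card_edgeSet_le G
  have hrow : ∀ I ∈ cliqueSystem G,
      ∑ v, bitSize (I.a v) + ∑ e, bitSize (I.b e) + bitSize I.c ≤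
        2 * Fintype.card V + 2 * Fintype.card V ^ 2 + 2 := by
    intro I hI
    obtain ⟨ha, hb, hc⟩ := natAbs_le_one_of_mem_cliqueSystem hI
    refine Nat.add_le_add (Nat.add_le_add ?_ ?_) (bitSize_le_two hc)
    · refine (Finset.sum_le_card_nsmul _ _ 2 fun v _ => bitSize_le_two (ha v)).trans ?_
      rw [smul_eq_mul, Finset.card_univ, mul_comm]
    · refine (Finset.sum_le_card_nsmul _ _ 2 fun e _ => bitSize_le_two (hb e)).trans ?_
      rw [smul_eq_mul, Finset.card_univ, mul_comm]
      exact Nat.mul_le_mul_left 2 (card_edgeSet_le G)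
  unfold encodingSize
  refine (Finset.sum_le_card_nsmul _ _ _ hrow).trans ?_
  rw [smul_eq_mul]
  exact Nat.mul_le_mul_right _ hcard

/-- For chordal graphs the clique system describes the polytope. -/
theorem IsChordal.extendedPolytope_eq {V : Type u} [Fintype V] {G : SimpleGraph V}
    (hG : IsChordal G) : extendedPolytope G =
      {p : Point G | (∀ v : V, ∑ e ∈ delta G v, p.2 e ≤ p.1 v) ∧ (∀ e : G.edgeSet, 0 ≤ p.2 e) ∧
        (∀ K : Finset V, IsMaximalClique G K →
          ∑ v ∈ K, p.1 v - ∑ e ∈ edgesIn G K, p.2 e ≤ 1)} :=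
  Set.Subset.antisymm (fun _ hp => valid_of_mem_extendedPolytope hp)
    fun _ hp => hG.mem_extendedPolytope hp.1 hp.2.1 hp.2.2

end CoTwoPlex

theorem mainTheorem3 :
    (∀ (V : Type u) [Fintype V] (G : SimpleGraph V),
      CoTwoPlex.IsChordal G ↔
        CoTwoPlex.extendedPolytope G =
          {p : CoTwoPlex.Point G |
            (∀ v : V, ∑ e ∈ CoTwoPlex.delta G v, p.2 e ≤ p.1 v) ∧
            (∀ e : G.edgeSet, 0 ≤ p.2 e) ∧
            (∀ K : Finset V, CoTwoPlex.IsMaximalClique G K →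
              ∑ v ∈ K, p.1 v - ∑ e ∈ CoTwoPlex.edgesIn G K, p.2 e ≤ 1)}) ∧
    (∃ q : Polynomial ℕ, ∀ (V : Type u) [Fintype V] (G : SimpleGraph V),
      CoTwoPlex.IsChordal G →
        CoTwoPlex.extendedPolytope G = CoTwoPlex.solutionSet (CoTwoPlex.cliqueSystem G) ∧
        CoTwoPlex.encodingSize (CoTwoPlex.cliqueSystem G) ≤ q.eval (Fintype.card V)) := by
  -- The first factor of the polynomial bounds the number of inequalities (vertices, edges, maximal
  -- cliques), the second the bits of one inequality, at two per entry in {-1, 0, 1}.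
  refine ⟨fun V _ G => ⟨fun hG => hG.extendedPolytope_eq, fun h => ?_⟩,
    (Polynomial.X + Polynomial.X ^ 2 + (Polynomial.X + 1)) *
      (2 * Polynomial.X + 2 * Polynomial.X ^ 2 + 2), fun V _ G hG => ⟨?_, ?_⟩⟩
  · refine CoTwoPlex.isChordal_of_forall_mem_extendedPolytope fun p h1 h2 h3 => ?_
    rw [h]
    exact ⟨h1, h2, h3⟩
  · rw [hG.extendedPolytope_eq]
    exact Set.ext fun p => (CoTwoPlex.mem_solutionSet_cliqueSystem G p).symm
  · simpa using hG.encodingSize_le
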